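/- For a string $w$, let $z(w)$ be the number of phrases of its LZ77 factorization without self-references, $w=p_1\cdots p_z$, in which each non-empty phrase $p_i$, with its last character removed, is the longest prefix of $p_i\cdots p_z$ that occurs in $p_1\cdots p_{i-1}$; as an exception, the last phrase $p_z$ may itself occur in $p_1\cdots p_{z-1}$. Let $z'(w)$ be the number of phrases of its LZ-End factorization $w=q_1\cdots q_{z'}$, in which each non-empty phrase $q_i$, with its last character removed, is the longest prefix of $q_i\cdots q_{z'}$ that is a suffix of $q_1\cdots q_j$ for some $0\le j<i$; as an exception, the last phrase $q_{z'}$ may itself be a suffix of $q_1\cdots q_j$ for some $j<z'$. Let $S_k$ be the $k$-th period-doubling sequence over the alphabet $\{a,b\}$: $S_0=a$ and $S_{k+1}=\phi(S_k)$, where $\phi$ is the morphism $a\mapsto ab$, $b\mapsto aa$. Then: 1. $z(S_k)=k+1$ for all $k\ge 0$. 2. There is $f:\mathbb N\to\mathbb N$ with $f(k)=O(\log^* k)$ as $k\to\infty$ such that $z'(S_k)=2k-f(k)$ for all $k\ge 1$. Here $\log^*$ is the iterated binary logarithm. 3. Consequently $z'(S_k)/z(S_k)\to 2$ as $k\to\infty$,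 so there is a family of binary strings along which the ratio of LZ-End phrases to LZ77 phrases tends to $2$. 4. The alphabet size $2$ is the least possible: for every unary string $c^n$ the LZ77 and the LZ-End factorizations coincide, and hence there is no sequence of unary strings $w_m$ for which $z'(w_m)/z(w_m)\to 2$. -/

import Mathlib

open Filter Topology Asymptotics

namespace LZ

/-! ### Greedy left-to-right factorizations -/

section Factorization

variable {α : Type*}

/-- `u` is the longest prefix of `t` that has the property `P`. -/
def IsLongestPrefix (P : List α → Prop) (t u : List α) : Prop :=
  u <+: t ∧ P u ∧ ∀ v, v <+: t → P v → v.length ≤ u.length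

/-- The list `p` of phrases is a factorization of `w` into non-empty phrases such that, for each
phrase `x` preceded by the phrases `pre` and followed by the phrases `post`, either `x` without its
last character is the longest prefix of the remaining text `x ++ post.flatten` that is an admissible
source with respect to `pre`, or `x` is the last phrase and is itself an admissible source. -/
def IsGreedyFactorization (Source : List (List α) → List α → Prop)
    (w : List α) (p : List (List α)) : Prop :=
  p.flatten = w ∧ ∀ pre x post, p = pre ++ x :: post →
    x ≠ [] ∧ (IsLongestPrefix (Source pre) (x ++ post.flatten) x.dropLast ∨
      (post = [] ∧ Source pre x))

/-- Sources for LZ77 (without self-references): strings occurring in the text parsed so far. -/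
def LZ77Source (pre : List (List α)) (u : List α) : Prop :=
  u <:+: pre.flatten

/-- Sources for LZ-End: strings occurring as a suffix of the concatenation of the first `j` phrases,
for some `j` at most the number of phrases parsed so far. -/
def LZEndSource (pre : List (List α)) (u : List α) : Prop :=
  ∃ j ≤ pre.length, u <:+ (pre.take j).flatten

/-- `p` is an LZ77 factorization of `w`. -/
def IsLZ77Factorization (w : List α) (p : List (List α)) : Prop :=
  IsGreedyFactorization LZ77Source w p

/-- `p` is an LZ-End factorization of `w`. -/
def IsLZEndFactorization (w : List α) (p : List (List α)) : Prop :=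
  IsGreedyFactorization LZEndSource w p

/-- Every string has a longest prefix with a property that the empty string has. -/
theorem exists_isLongestPrefix (P : List α → Prop) (h : P []) (t : List α) :
    ∃ u, IsLongestPrefix P t u := by
  classical
  let Q : ℕ → Prop := fun n => P (t.take n)
  have h0 : Q 0 := by simpa [Q] using h
  refine ⟨t.take (Nat.findGreatest Q t.length), List.take_prefix _ _,
    Nat.findGreatest_spec (P := Q) (Nat.zero_le _) h0, ?_⟩
  intro v hv hP
  have hl := hv.length_le
  have hv' : v = t.take v.length := List.prefix_iff_eq_take.1 hv
  have hq : Q v.length := by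
    show P (t.take v.length)
    rw [← hv']
    exact hP
  have := Nat.le_findGreatest hl hq
  have h2 := Nat.findGreatest_le (P := Q) t.length
  simp only [List.length_take]
  omega

theorem exists_greedy_aux (Source : List (List α) → List α → Prop) (h : ∀ pre, Source pre []) :
    ∀ (n : ℕ) (pre0 : List (List α)) (t : List α), t.length ≤ n →
      ∃ p : List (List α), p.flatten = t ∧ ∀ pre x post, p = pre ++ x :: post →
        x ≠ [] ∧ (IsLongestPrefix (Source (pre0 ++ pre)) (x ++ post.flatten) x.dropLast ∨
          (post = [] ∧ Source (pre0 ++ pre) x)) := by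
  intro n
  induction n with
  | zero =>
    intro pre0 t ht
    exact ⟨[], by simpa using (List.length_eq_zero_iff.1 (Nat.le_zero.1 ht)).symm, by simp⟩
  | succ n ih =>
    intro pre0 t ht
    rcases eq_or_ne t [] with rfl | hne
    · exact ⟨[], by simp, by simp⟩
    obtain ⟨u, hu⟩ := exists_isLongestPrefix (Source pre0) (h pre0) t
    obtain ⟨s, rfl⟩ := hu.1
    cases s with
    | nil =>
      refine ⟨[u], by simp, ?_⟩
      intro pre x post hp
      cases pre with
      | nil =>
        simp only [List.nil_append, List.cons.injEq] at hp
        obtain ⟨rfl, rfl⟩ := hp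
        exact ⟨by simpa using hne, Or.inr ⟨rfl, by simpa using hu.2.1⟩⟩
      | cons y pre => simp at hp
    | cons c s =>
      obtain ⟨p, hp, hg⟩ := ih (pre0 ++ [u ++ [c]]) s (by simp at ht; omega)
      refine ⟨(u ++ [c]) :: p, by simp [hp], ?_⟩
      intro pre x post he
      cases pre with
      | nil =>
        simp only [List.nil_append, List.cons.injEq] at he
        obtain ⟨rfl, rfl⟩ := he
        refine ⟨by simp, Or.inl ?_⟩
        simpa [hp] using hu
      | cons y pre =>
        simp only [List.cons_append, List.cons.injEq] at he
        obtain ⟨rfl, he⟩ := he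
        simpa using hg pre x post he

theorem greedy_unique_aux (Source : List (List α) → List α → Prop) :
    ∀ (p q pre0 : List (List α)), p.flatten = q.flatten →
      (∀ pre x post, p = pre ++ x :: post →
        x ≠ [] ∧ (IsLongestPrefix (Source (pre0 ++ pre)) (x ++ post.flatten) x.dropLast ∨
          (post = [] ∧ Source (pre0 ++ pre) x))) →
      (∀ pre x post, q = pre ++ x :: post →
        x ≠ [] ∧ (IsLongestPrefix (Source (pre0 ++ pre)) (x ++ post.flatten) x.dropLast ∨
          (post = [] ∧ Source (pre0 ++ pre) x))) → p = q := by
  intro p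
  induction p with
  | nil =>
    intro q pre0 hf _ hq
    cases q with
    | nil => rfl
    | cons y q => exact absurd (by simp at hf; exact hf.1) (hq [] y q rfl).1
  | cons x p ih =>
    intro q pre0 hf hp hq
    cases q with
    | nil => exact absurd (by simp at hf; exact hf.1) (hp [] x p rfl).1
    | cons y q =>
      have hf' : x ++ p.flatten = y ++ q.flatten := by simpa using hf
      obtain ⟨hx, hx'⟩ := hp [] x p rfl
      obtain ⟨hy, hy'⟩ := hq [] y q rfl
      have lx := List.length_pos_iff.2 hx
      have ly := List.length_pos_iff.2 hy
      have hlen := congrArg List.length hf'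
      simp only [List.length_append] at hlen
      have key : x.length = y.length := by
        rcases hx' with hx' | ⟨rfl, hx'⟩ <;> rcases hy' with hy' | ⟨rfl, hy'⟩
        · have h1 := hx'.2.2 _ (hf' ▸ hy'.1) hy'.2.1
          have h2 := hy'.2.2 _ (hf' ▸ hx'.1) hx'.2.1
          simp only [List.length_dropLast] at h1 h2
          omega
        · have h1 := hx'.2.2 y (hf' ▸ List.prefix_append _ _) hy'
          simp only [List.length_dropLast] at h1
          simp at hlen
          omega
        · have h1 := hy'.2.2 x (hf' ▸ List.prefix_append _ _) hx'
          simp only [List.length_dropLast] at h1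
          simp at hlen
          omega
        · simpa using hlen
      obtain ⟨rfl, hr⟩ := List.append_inj hf' key
      congr 1
      refine ih q (pre0 ++ [x]) hr ?_ ?_
      · intro pre z post he
        simpa using hp (x :: pre) z post (by simp [he])
      · intro pre z post he
        simpa using hq (x :: pre) z post (by simp [he])

theorem existsUnique_greedy (Source : List (List α) → List α → Prop) (h : ∀ pre, Source pre [])
    (w : List α) : ∃! p, IsGreedyFactorization Source w p := by
  obtain ⟨p, hp, hg⟩ := exists_greedy_aux Source h w.length [] w le_rfl
  refine ⟨p, ⟨hp, by simpa using hg⟩, ?_⟩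
  rintro q ⟨hq, hg'⟩
  exact greedy_unique_aux Source q p [] (hq.trans hp.symm) (by simpa using hg') (by simpa using hg)

theorem existsUnique_lz77 (w : List α) : ∃! p, IsLZ77Factorization w p :=
  existsUnique_greedy LZ77Source (fun pre => List.nil_infix (l := pre.flatten)) w

theorem existsUnique_lzEnd (w : List α) : ∃! p, IsLZEndFactorization w p :=
  existsUnique_greedy LZEndSource (fun _ => ⟨0, Nat.zero_le _, List.nil_suffix⟩) w

/-- The LZ77 factorization of `w` (the unique one). -/
noncomputable def lz77 (w : List α) : List (List α) := (existsUnique_lz77 w).choose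

/-- The LZ-End factorization of `w` (the unique one). -/
noncomputable def lzEnd (w : List α) : List (List α) := (existsUnique_lzEnd w).choose

theorem lz77_eq_iff {w : List α} {p : List (List α)} :
    lz77 w = p ↔ IsLZ77Factorization w p :=
  ⟨fun h => h ▸ (existsUnique_lz77 w).choose_spec.1,
    fun h => ((existsUnique_lz77 w).choose_spec.2 p h).symm⟩

theorem lzEnd_eq_iff {w : List α} {p : List (List α)} :
    lzEnd w = p ↔ IsLZEndFactorization w p :=
  ⟨fun h => h ▸ (existsUnique_lzEnd w).choose_spec.1,
    fun h => ((existsUnique_lzEnd w).choose_spec.2 p h).symm⟩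

/-- The number of LZ77 phrases of `w`. -/
noncomputable def numLZ77 (w : List α) : ℕ := (lz77 w).length

/-- The number of LZ-End phrases of `w`. -/
noncomputable def numLZEnd (w : List α) : ℕ := (lzEnd w).length

end Factorization

/-! ### Period-doubling sequences, over the binary alphabet `a = false`, `b = true` -/

/-- The images of the letters under the period-doubling morphism: `a ↦ ab`, `b ↦ aa`. -/
def pdLetter : Bool → List Bool
  | false => [false, true]
  | true => [false, false]

/-- The `k`-th period-doubling sequence: `S 0 = a`, and `S (k + 1)` is the image of `S k` under the
morphism `a ↦ ab`, `b ↦ aa`. -/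
def periodDoubling : ℕ → List Bool
  | 0 => [false]
  | k + 1 => (periodDoubling k).flatMap pdLetter

/-- The equivalent recursion: `S (k + 1)` is `S k` followed by `S k` with its last letter
flipped. -/
theorem periodDoubling_succ (k : ℕ) : ∃ u c, periodDoubling k = u ++ [c] ∧
    periodDoubling (k + 1) = (u ++ [c]) ++ (u ++ [!c]) := by
  induction k with
  | zero => exact ⟨[], false, rfl, rfl⟩
  | succ k ih =>
    obtain ⟨u, c, h1, h2⟩ := ih
    refine ⟨u ++ [c] ++ u, !c, by simp [h2], ?_⟩
    have h3 : periodDoubling (k + 1) = (u ++ [c]).flatMap pdLetter := by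
      rw [← h1]; rfl
    have h4 : periodDoubling (k + 2) = (periodDoubling (k + 1)).flatMap pdLetter := rfl
    rw [h4, h2, List.flatMap_append, ← h3, h2]
    have h5 : u.flatMap pdLetter ++ pdLetter c = u ++ [c] ++ u ++ [!c] := by
      have := h3.symm.trans h2
      simpa using this
    have h6 : (u ++ [!c]).flatMap pdLetter = u.flatMap pdLetter ++ pdLetter (!c) := by simp
    rw [h6]
    cases c <;> simp only [pdLetter, Bool.not_false, Bool.not_true] at h5 ⊢
    · have : u.flatMap pdLetter ++ [false] = u ++ [false] ++ u := by
        have h7 : (u.flatMap pdLetter ++ [false]) ++ [true] = (u ++ [false] ++ u) ++ [true] := by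
          simpa using h5
        exact List.append_cancel_right h7
      have h8 : u.flatMap pdLetter ++ [false, false] =
          (u.flatMap pdLetter ++ [false]) ++ [false] := by simp
      rw [h8, this]
      simp
    · have : u.flatMap pdLetter ++ [false] = u ++ [true] ++ u := by
        have h7 : (u.flatMap pdLetter ++ [false]) ++ [false] = (u ++ [true] ++ u) ++ [false] := by
          simpa using h5
        exact List.append_cancel_right h7
      have h8 : u.flatMap pdLetter ++ [false, true] =
          (u.flatMap pdLetter ++ [false]) ++ [true] := by simp
      rw [h8, this]
      simp

/-! ### The iterated logarithm -/

/-- The iterated logarithm `log* x`: the least number of times that the binary logarithm has to be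
applied to `x` to reach a value at most `1`. -/
noncomputable def logStar (x : ℝ) : ℕ :=
  sInf {i : ℕ | (Real.logb 2)^[i] x ≤ 1}

theorem logStar_nonempty (x : ℝ) : {i : ℕ | (Real.logb 2)^[i] x ≤ 1}.Nonempty := by
  have key : ∀ (n : ℕ) (x : ℝ), x ≤ n + 1 → ∃ i : ℕ, (Real.logb 2)^[i] x ≤ 1 := by
    intro n
    induction n with
    | zero => intro x hx; exact ⟨0, by simpa using hx⟩
    | succ n ih =>
      intro x hx
      rcases le_or_gt x 1 with h1 | h1
      · exact ⟨0, by simpa using h1⟩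
      · have hlog : Real.logb 2 x ≤ (n : ℝ) + 1 := by
          rw [Real.logb_le_iff_le_rpow (by norm_num) (by linarith)]
          have h2 : (n + 1 : ℕ) + 1 ≤ 2 ^ (n + 1) := Nat.lt_two_pow_self
          have h3 : ((n + 1 : ℕ) : ℝ) + 1 ≤ 2 ^ (n + 1) := by exact_mod_cast h2
          have h4 : (2 : ℝ) ^ ((n : ℝ) + 1) = 2 ^ (n + 1) := by
            rw [← Real.rpow_natCast]; push_cast; rfl
          rw [h4]; linarith
        obtain ⟨i, hi⟩ := ih _ hlog
        exact ⟨i + 1, by simpa using hi⟩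
  obtain ⟨n, hn⟩ := exists_nat_ge x
  exact key n x (by linarith)

end LZ

/-!
Greedy phrases other than the last one depend only on the text to their left and on the letters they
meet, so the factorizations of `S_k` can be read off the greedy parsing of the infinite
period-doubling word `d`, where `d x` is the parity of the exponent of `2` in `x`.

Copies exist because `d (x + t) = d x` whenever `2 ^ a ∣ t` and `2 ^ a ∤ x`. Conversely, an odd
shift cannot preserve three consecutive letters, so by desubstitution a copy of length at least
`3 * 2 ^ m / 2` has a shift divisible by `2 ^ m`, and comparing the letters at the multiples of
`2 ^ m` confines the end of the earlier occurrence to a short window. For LZ77 the phrases end at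
the powers of `2`. For LZ-End let `γ` be the gap between `2 ^ j` and the last phrase end at or
before it. If `γ = 0`, the next phrase ends just beyond `13 * 2 ^ j / 8`; if `γ > 0`, the next two
phrases end at distance `γ - 1` before `5 * 2 ^ j / 4` and before `2 ^ (j + 1)`. Each power of `2`
thus contributes two phrases, except those with `γ = 0`; after such a `2 ^ j` the gap is about
`3 * 2 ^ j / 8` and takes that many steps to return to `0`, leaving only `O(log* k)` exceptions.
When `γ > 0`, the end of `S_k` lies inside a phrase; `S_k` without its last letter is a palindrome,
and this makes the unfinished phrase, up to its last letter, a suffix of a prefix of length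
`2 ^ b - 1` that ends with a phrase.

Over a unary alphabet every occurrence is also a suffix, so the two factorizations coincide.
-/

namespace LZ

/-! ### Factors of infinite words -/

section Factor

variable {α : Type*} (d : ℕ → α)

/-- The factor `d (p + 1) ⋯ d n` of the infinite word `d`, whose letters are indexed from `1`, so
that `factor d 0 n` is the prefix of length `n`. -/
def factor (p n : ℕ) : List α :=
  (List.Ico (p + 1) (n + 1)).map d

@[simp]
theorem length_factor (p n : ℕ) : (factor d p n).length = n - p := by
  simp [factor]

@[simp]
theorem factor_self (p : ℕ) : factor d p p = [] := by
  simp [factor]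

theorem factor_ne_nil {p n : ℕ} (h : p < n) : factor d p n ≠ [] := by
  rw [← List.length_pos_iff, length_factor]
  omega

theorem factor_append {p q n : ℕ} (hpq : p ≤ q) (hqn : q ≤ n) :
    factor d p q ++ factor d q n = factor d p n := by
  rw [factor, factor, ← List.map_append, List.Ico.append_consecutive (by omega) (by omega), factor]

theorem factor_succ {p n : ℕ} (h : p ≤ n) : factor d p (n + 1) = factor d p n ++ [d (n + 1)] := by
  rw [factor, List.Ico.succ_top (by omega), List.map_append, List.map_singleton, factor]

theorem dropLast_factor {p n : ℕ} (h : p < n) : (factor d p n).dropLast = factor d p (n - 1) := by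
  obtain ⟨n, rfl⟩ := Nat.exists_eq_add_of_lt h
  rw [factor_succ d (by omega), List.dropLast_concat, Nat.add_sub_cancel]

theorem factor_prefix {p q n : ℕ} (hpq : p ≤ q) (hqn : q ≤ n) : factor d p q <+: factor d p n :=
  ⟨_, factor_append d hpq hqn⟩

theorem prefix_factor_iff {p n : ℕ} (h : p ≤ n) {v : List α} :
    v <+: factor d p n ↔ ∃ q, p ≤ q ∧ q ≤ n ∧ v = factor d p q := by
  refine ⟨fun hv => ⟨p + v.length, by omega, ?_, ?_⟩, ?_⟩
  · have := hv.length_le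
    rw [length_factor] at this
    omega
  · have hlen := hv.length_le
    rw [length_factor] at hlen
    exact List.prefix_of_prefix_length_le hv (factor_prefix d (by omega) (by omega)) (by simp)
      |>.eq_of_length (by simp)
  · rintro ⟨q, hpq, hqn, rfl⟩
    exact factor_prefix d hpq hqn

@[simp]
theorem getElem_factor {p n i : ℕ} (h : i < (factor d p n).length) :
    (factor d p n)[i] = d (p + 1 + i) := by
  simp [factor, List.Ico]

/-- The factor of `d` at the positions `p + 1, …, n` also occurs in `d` ending at position `e`:
the index `x + e - n` is the position in that occurrence that corresponds to `x`. -/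
def CopyEndsAt (p n e : ℕ) : Prop :=
  n - p ≤ e ∧ ∀ x, p < x → x ≤ n → d (x + e - n) = d x

theorem factor_suffix_iff {p n e : ℕ} : factor d p n <:+ factor d 0 e ↔ CopyEndsAt d p n e := by
  rw [List.suffix_iff_getElem, CopyEndsAt]
  simp only [length_factor, getElem_factor, Nat.sub_zero, exists_prop, and_congr_right_iff]
  refine fun hle => ⟨fun h x hpx hxn => ?_, fun h i hi => ?_⟩
  · convert h (x - p - 1) (by omega) using 2 <;> omega
  · convert h (p + 1 + i) (by omega) (by omega) using 2
    omega

end Factor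

/-! ### Greedy parsings of infinite words -/

section GreedyParse

variable {α : Type*} {d : ℕ → α} {Source : List (List α) → List α → Prop}

/-- The phrases of the prefix of `d` whose end positions, from the last one down to `0`, are
listed. -/
def phrases (d : ℕ → α) : List ℕ → List (List α)
  | n :: p :: l => phrases d (p :: l) ++ [factor d p n]
  | _ => []

/-- The list holds the end positions, from the last one down to `0`, of the first phrases of the
greedy parsing of the infinite word `d`: each phrase without its last letter is an admissible
source, and the phrase itself and its continuations are not. -/
inductive IsGreedyParse (Source : List (List α) → List α → Prop) (d : ℕ → α) : List ℕ → Prop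
  | zero : IsGreedyParse Source d [0]
  | cons {n p : ℕ} {l : List ℕ} (parse : IsGreedyParse Source d (p :: l)) (lt : p < n)
      (source : Source (phrases d (p :: l)) (factor d p (n - 1)))
      (maximal : ∀ n' ≥ n, ¬ Source (phrases d (p :: l)) (factor d p n')) :
      IsGreedyParse Source d (n :: p :: l)

theorem length_phrases (d : ℕ → α) : ∀ l, (phrases d l).length = l.length - 1
  | [] | [_] => rfl
  | n :: p :: l => by simp [phrases, length_phrases d (p :: l)]

theorem IsGreedyParse.flatten_phrases {p : ℕ} {l : List ℕ} (h : IsGreedyParse Source d (p :: l)) :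
    (phrases d (p :: l)).flatten = factor d 0 p := by
  generalize hl : p :: l = l' at h
  induction h generalizing p l with
  | zero =>
    obtain ⟨rfl, rfl⟩ := List.cons.inj hl
    simp [phrases]
  | cons _ lt _ _ ih =>
    obtain ⟨rfl, rfl⟩ := List.cons.inj hl
    rw [phrases, List.flatten_append, ih rfl, List.flatten_singleton,
      factor_append d (Nat.zero_le _) lt.le]

theorem isLongestPrefix_factor {P : List α → Prop} {p m n : ℕ} (hpm : p ≤ m) (hmn : m ≤ n)
    (hP : P (factor d p m)) (hmax : ∀ q, m < q → q ≤ n → ¬ P (factor d p q)) :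
    IsLongestPrefix P (factor d p n) (factor d p m) := by
  refine ⟨factor_prefix d hpm hmn, hP, fun v hv hPv => ?_⟩
  obtain ⟨q, -, hqn, rfl⟩ := (prefix_factor_iff d (hpm.trans hmn)).1 hv
  have hqm : q ≤ m := not_lt.1 fun h => hmax q h hqn hPv
  simp only [length_factor]
  omega

theorem IsGreedyParse.isLongestPrefix {p n : ℕ} {l : List ℕ} (h : IsGreedyParse Source d (p :: l))
    (hpn : p ≤ n) {pre post : List (List α)} {x : List α}
    (hsplit : phrases d (p :: l) = pre ++ x :: post) :
    x ≠ [] ∧ IsLongestPrefix (Source pre) (x ++ post.flatten ++ factor d p n) x.dropLast := by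
  generalize hl : p :: l = l' at h
  induction h generalizing p l post with
  | zero =>
    obtain ⟨rfl, rfl⟩ := List.cons.inj hl
    simp [phrases] at hsplit
  | @cons m q l'' _ lt source maximal ih =>
    obtain ⟨rfl, rfl⟩ := List.cons.inj hl
    rw [phrases] at hsplit
    rcases post.eq_nil_or_concat with rfl | ⟨post, y, rfl⟩
    · obtain ⟨rfl, hx⟩ := List.append_inj' hsplit rfl
      obtain rfl := List.singleton_inj.1 hx
      rw [List.flatten_nil, List.append_nil, factor_append d lt.le hpn, dropLast_factor d lt]
      exact ⟨factor_ne_nil d lt, isLongestPrefix_factor (by omega) (by omega) source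
        fun q hq _ => maximal q (by omega)⟩
    · rw [List.concat_eq_append, ← List.cons_append, ← List.append_assoc] at hsplit
      obtain ⟨hpre, hy⟩ := List.append_inj' hsplit rfl
      obtain rfl := List.singleton_inj.1 hy
      rw [List.concat_eq_append, List.flatten_append, List.flatten_singleton, List.append_assoc,
        List.append_assoc, factor_append d lt.le hpn, ← List.append_assoc]
      exact ih (lt.le.trans hpn) hpre rfl

theorem IsGreedyParse.isGreedyFactorization {p n : ℕ} {l : List ℕ}
    (h : IsGreedyParse Source d (p :: l)) (hpn : p < n)
    (hsource : Source (phrases d (p :: l)) (factor d p (n - 1))) :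
    IsGreedyFactorization Source (factor d 0 n) (phrases d (n :: p :: l)) := by
  rw [phrases]
  refine ⟨by rw [List.flatten_append, h.flatten_phrases, List.flatten_singleton,
    factor_append d (Nat.zero_le p) hpn.le], fun pre x post hsplit => ?_⟩
  rcases post.eq_nil_or_concat with rfl | ⟨post, y, rfl⟩
  · obtain ⟨rfl, hx⟩ := List.append_inj' hsplit rfl
    obtain rfl := List.singleton_inj.1 hx
    refine ⟨factor_ne_nil d hpn, or_iff_not_imp_right.2 fun hlast => ?_⟩
    rw [List.flatten_nil, List.append_nil, dropLast_factor d hpn]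
    refine isLongestPrefix_factor (by omega) (by omega) hsource fun q hq hqn hq' => hlast ?_
    obtain rfl : q = n := by omega
    exact ⟨rfl, hq'⟩
  · rw [List.concat_eq_append, ← List.cons_append, ← List.append_assoc] at hsplit
    obtain ⟨hpre, hy⟩ := List.append_inj' hsplit rfl
    obtain rfl := List.singleton_inj.1 hy
    rw [List.concat_eq_append, List.flatten_append, List.flatten_singleton, ← List.append_assoc]
    exact (h.isLongestPrefix hpn.le hpre).imp_right Or.inl

theorem IsGreedyParse.isGreedyFactorization_head {n : ℕ} {l : List ℕ}
    (h : IsGreedyParse Source d (n :: l)) :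
    IsGreedyFactorization Source (factor d 0 n) (phrases d (n :: l)) := by
  cases h with
  | zero => exact ⟨rfl, by simp [phrases]⟩
  | cons parse lt source _ => exact parse.isGreedyFactorization lt source

theorem lzEndSource_append_singleton (pre : List (List α)) (x u : List α) :
    LZEndSource (pre ++ [x]) u ↔ u <:+ (pre ++ [x]).flatten ∨ LZEndSource pre u := by
  constructor
  · rintro ⟨j, -, h⟩
    rcases Nat.lt_or_ge pre.length j with hlt | hle
    · rw [List.take_of_length_le (by simpa using hlt)] at h
      exact Or.inl h
    · rw [List.take_append_of_le_length hle] at h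
      exact Or.inr ⟨j, hle, h⟩
  · rintro (h | ⟨j, hj, h⟩)
    · exact ⟨(pre ++ [x]).length, le_rfl, by rwa [List.take_length]⟩
    · exact ⟨j, by simp only [List.length_append]; omega, by
        rwa [List.take_append_of_le_length hj]⟩

theorem IsGreedyParse.lzEndSource_iff {l : List ℕ} (h : IsGreedyParse Source d l) (p n : ℕ) :
    LZEndSource (phrases d l) (factor d p n) ↔ ∃ e ∈ l, CopyEndsAt d p n e := by
  simp only [← factor_suffix_iff]
  induction h with
  | zero => simp [phrases, LZEndSource]
  | cons parse lt source maximal ih =>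
    have hflat := (IsGreedyParse.cons parse lt source maximal).flatten_phrases
    rw [phrases] at hflat ⊢
    rw [lzEndSource_append_singleton, hflat, ih]
    simp

theorem IsGreedyParse.cons_lzEnd {n p e : ℕ} {l : List ℕ}
    (h : IsGreedyParse LZEndSource d (p :: l)) (hpn : p < n)
    (he : e ∈ p :: l) (hcopy : CopyEndsAt d p (n - 1) e)
    (hmax : ∀ n' ≥ n, ∀ e ∈ p :: l, ¬ CopyEndsAt d p n' e) :
    IsGreedyParse LZEndSource d (n :: p :: l) := by
  refine .cons h hpn ((h.lzEndSource_iff _ _).2 ⟨e, he, hcopy⟩) fun n' hn' hsource => ?_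
  obtain ⟨e, he, hcopy⟩ := (h.lzEndSource_iff _ _).1 hsource
  exact hmax n' hn' e he hcopy

theorem IsGreedyParse.numLZEnd_factor {p n e : ℕ} {l : List ℕ}
    (h : IsGreedyParse LZEndSource d (p :: l)) (hpn : p < n)
    (he : e ∈ p :: l) (hcopy : CopyEndsAt d p (n - 1) e) :
    numLZEnd (factor d 0 n) = l.length + 1 := by
  have := h.isGreedyFactorization hpn ((h.lzEndSource_iff _ _).2 ⟨e, he, hcopy⟩)
  rw [numLZEnd, lzEnd_eq_iff.2 this, length_phrases, List.length_cons, List.length_cons,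
    Nat.add_sub_cancel]

theorem IsGreedyParse.numLZ77_head {n : ℕ} {l : List ℕ}
    (h : IsGreedyParse LZ77Source d (n :: l)) : numLZ77 (factor d 0 n) = l.length := by
  rw [numLZ77, lz77_eq_iff.2 h.isGreedyFactorization_head, length_phrases, List.length_cons,
    Nat.add_sub_cancel]

theorem IsGreedyParse.numLZEnd_head {n : ℕ} {l : List ℕ}
    (h : IsGreedyParse LZEndSource d (n :: l)) : numLZEnd (factor d 0 n) = l.length := by
  rw [numLZEnd, lzEnd_eq_iff.2 h.isGreedyFactorization_head, length_phrases, List.length_cons,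
    Nat.add_sub_cancel]

end GreedyParse

/-! ### The period-doubling word -/

/-- The infinite period-doubling word, in closed form: its `x`-th letter, for `x ≥ 1`, is the parity
of the exponent of `2` in `x`. -/
def pdChar (x : ℕ) : Bool :=
  decide (Odd (padicValNat 2 x))

theorem pdChar_odd {x : ℕ} (hx : Odd x) : pdChar x = false := by
  simp [pdChar, padicValNat.eq_zero_of_not_dvd hx.not_two_dvd_nat]

theorem pdChar_two_mul {x : ℕ} (hx : x ≠ 0) : pdChar (2 * x) = !pdChar x := by
  rw [pdChar, padicValNat.mul two_ne_zero hx, padicValNat_self, pdChar, add_comm,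
    ← decide_not, decide_eq_decide, Nat.odd_add_one]

theorem pdChar_of_mod_four_eq_two {x : ℕ} (hx : x % 4 = 2) : pdChar x = true := by
  obtain ⟨y, rfl⟩ : ∃ y, x = 2 * (2 * y + 1) := ⟨x / 4, by omega⟩
  rw [pdChar_two_mul (by omega), pdChar_odd ⟨y, rfl⟩, Bool.not_false]

theorem pdChar_iff_of_le_ten {x : ℕ} (h0 : 0 < x) (h : x ≤ 10) :
    pdChar x = true ↔ x = 2 ∨ x = 6 ∨ x = 8 ∨ x = 10 := by
  obtain hx | hx | ⟨y, rfl⟩ : Odd x ∨ x % 4 = 2 ∨ ∃ y, x = 2 * (2 * y) := by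
    rcases x.even_or_odd' with ⟨z, rfl | rfl⟩
    · rcases z.even_or_odd' with ⟨y, rfl | rfl⟩
      · exact Or.inr (Or.inr ⟨y, rfl⟩)
      · exact Or.inr (Or.inl (by omega))
    · exact Or.inl ⟨z, rfl⟩
  · rw [pdChar_odd hx]
    obtain ⟨z, rfl⟩ := hx
    simp
    omega
  · simp only [pdChar_of_mod_four_eq_two hx, true_iff]
    omega
  · rw [pdChar_two_mul (by omega), pdChar_two_mul (by omega), Bool.not_not]
    obtain rfl | rfl : y = 1 ∨ y = 2 := by omega
    · simp [pdChar_odd]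
    · simp [pdChar_of_mod_four_eq_two]

theorem pdChar_eq_iff_of_le_ten {x y : ℕ} (hx : 0 < x ∧ x ≤ 10) (hy : 0 < y ∧ y ≤ 10) :
    pdChar x = pdChar y ↔
      ((x = 2 ∨ x = 6 ∨ x = 8 ∨ x = 10) ↔ (y = 2 ∨ y = 6 ∨ y = 8 ∨ y = 10)) := by
  rw [Bool.eq_iff_iff, pdChar_iff_of_le_ten hx.1 hx.2, pdChar_iff_of_le_ten hy.1 hy.2]

theorem pdChar_two_pow_mul_eq_iff {y z : ℕ} (hy : y ≠ 0) (hz : z ≠ 0) (m : ℕ) :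
    pdChar (2 ^ m * y) = pdChar (2 ^ m * z) ↔ pdChar y = pdChar z := by
  induction m with
  | zero => simp
  | succ m ih =>
    rw [pow_succ', mul_assoc, mul_assoc, pdChar_two_mul (by positivity),
      pdChar_two_mul (by positivity), Bool.not_inj_iff, ih]

theorem pdChar_two_mul_eq_iff {y z : ℕ} (hy : y ≠ 0) (hz : z ≠ 0) :
    pdChar (2 * y) = pdChar (2 * z) ↔ pdChar y = pdChar z := by
  simpa using pdChar_two_pow_mul_eq_iff hy hz 1

theorem pdChar_add_of_not_dvd {a x t : ℕ} (hx : ¬ 2 ^ a ∣ x) (ht : 2 ^ a ∣ t) :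
    pdChar (x + t) = pdChar x := by
  induction a generalizing x t with
  | zero => simp at hx
  | succ a ih =>
    obtain ⟨t, rfl⟩ := ht
    rw [pow_succ'] at hx
    rw [pow_succ', mul_assoc]
    rcases x.even_or_odd' with ⟨x, rfl | rfl⟩
    · have hx' : ¬ 2 ^ a ∣ x := fun h => hx (Nat.mul_dvd_mul_left 2 h)
      have hx0 : x ≠ 0 := fun h => hx' (h ▸ dvd_zero _)
      rw [← mul_add, pdChar_two_mul_eq_iff (by omega) hx0, ih hx' ⟨t, rfl⟩]
    · rw [pdChar_odd ⟨x, rfl⟩, pdChar_odd ⟨x + 2 ^ a * t, by ring⟩]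

theorem pdChar_two_pow_sub {a x : ℕ} (h0 : 0 < x) (ha : x < 2 ^ a) :
    pdChar (2 ^ a - x) = pdChar x := by
  induction a generalizing x with
  | zero => omega
  | succ a ih =>
    rw [pow_succ'] at ha ⊢
    rcases x.even_or_odd' with ⟨x, rfl | rfl⟩
    · rw [← Nat.mul_sub, pdChar_two_mul_eq_iff (by omega) (by omega), ih (by omega) (by omega)]
    · rw [pdChar_odd ⟨x, rfl⟩, pdChar_odd ⟨2 ^ a - x - 1, by omega⟩]

theorem factor_pdChar_two_mul (n : ℕ) :
    factor pdChar 0 (2 * n) = (factor pdChar 0 n).flatMap pdLetter := by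
  induction n with
  | zero => simp
  | succ n ih =>
    have hodd : pdChar (2 * n + 1) = false := pdChar_odd ⟨n, rfl⟩
    have heven : pdChar (2 * n + 1 + 1) = !pdChar (n + 1) := pdChar_two_mul n.succ_ne_zero
    rw [mul_add_one, factor_succ _ (by omega), factor_succ _ (by omega), ih,
      factor_succ _ (by omega), List.flatMap_append, List.append_assoc, hodd, heven]
    cases pdChar (n + 1) <;> rfl

theorem periodDoubling_eq_factor (k : ℕ) : periodDoubling k = factor pdChar 0 (2 ^ k) := by
  induction k with
  | zero =>
    rw [periodDoubling, pow_zero, ← zero_add 1, factor_succ _ le_rfl, factor_self, zero_add,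
      pdChar_odd odd_one, List.nil_append]
  | succ k ih => rw [periodDoubling, ih, pow_succ', factor_pdChar_two_mul]

/-! ### Copies inside the period-doubling word -/

theorem copyEndsAt_add_two_pow {j p e : ℕ} (hp : 2 ^ j ≤ p) (he : e < 2 ^ j) :
    CopyEndsAt pdChar p (e + 2 ^ j) e := by
  refine ⟨by omega, fun x hpx hxn => ?_⟩
  obtain ⟨y, rfl⟩ := Nat.exists_eq_add_of_le (hp.trans hpx.le)
  have hy : ¬ 2 ^ j ∣ y := Nat.not_dvd_of_pos_of_lt (by omega) (by omega)
  rw [show 2 ^ j + y + e - (e + 2 ^ j) = y by omega, add_comm, pdChar_add_of_not_dvd hy dvd_rfl]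

-- With `j = m + 3`, the positions `8 * 2 ^ m = 2 ^ j`, `10 * 2 ^ m = 5 * 2 ^ j / 4` and
-- `16 * 2 ^ m = 2 ^ (j + 1)` are those just before which the LZ-End phrases end when the gap `γ`
-- to `2 ^ j` is positive.
theorem copyEndsAt_lower {m γ : ℕ} (h0 : 1 ≤ γ) (hγ : γ ≤ 2 * 2 ^ m) :
    CopyEndsAt pdChar (8 * 2 ^ m - γ) (10 * 2 ^ m - γ) (8 * 2 ^ m - γ) := by
  refine ⟨by omega, fun x hpx hxn => ?_⟩
  obtain ⟨z, rfl⟩ : ∃ z, x = z + 2 ^ (m + 1) := ⟨x - 2 ^ (m + 1), by omega⟩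
  rw [show z + 2 ^ (m + 1) + (8 * 2 ^ m - γ) - (10 * 2 ^ m - γ) = z by omega]
  by_cases hz : 2 ^ (m + 1) ∣ z
  · obtain ⟨y, rfl⟩ := hz
    have h2 : 2 < y := Nat.lt_of_mul_lt_mul_left (a := 2 ^ (m + 1)) (by omega)
    have h4 : y < 4 := Nat.lt_of_mul_lt_mul_left (a := 2 ^ (m + 1)) (by omega)
    obtain rfl : y = 3 := by omega
    rw [← mul_add_one, pdChar_two_pow_mul_eq_iff (by simp) (by simp),
      pdChar_eq_iff_of_le_ten (by simp) (by simp)]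
    simp
  · rw [pdChar_add_of_not_dvd hz dvd_rfl]

theorem copyEndsAt_two_pow_sub_one {a b δ : ℕ} (h0 : 1 ≤ δ) (ha : δ ≤ 2 ^ a) (hb : δ ≤ 2 ^ b) :
    CopyEndsAt pdChar (2 ^ a - δ) (2 ^ a - 1) (2 ^ b - 1) := by
  refine ⟨by omega, fun x hpx hxn => ?_⟩
  obtain ⟨y, hy⟩ : ∃ y, x + y = 2 ^ a := ⟨2 ^ a - x, by omega⟩
  rw [show x + (2 ^ b - 1) - (2 ^ a - 1) = 2 ^ b - y by omega, show x = 2 ^ a - y by omega,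
    pdChar_two_pow_sub (a := b) (by omega) (by omega), pdChar_two_pow_sub (by omega) (by omega)]

/-! ### Rigidity of copies inside the period-doubling word -/

theorem even_of_pdChar_sub_eq {y t : ℕ} (hty : t < y)
    (h : ∀ x, y ≤ x → x ≤ y + 2 → pdChar (x - t) = pdChar x) : Even t := by
  by_contra ht
  rw [Nat.not_even_iff_odd, Nat.odd_iff] at ht
  have not_both {u v : ℕ} (hu : u % 4 = 2) (hv : Odd v) : pdChar u ≠ pdChar v := by
    simp [pdChar_of_mod_four_eq_two hu, pdChar_odd hv]
  obtain ⟨x, hyx, hxy, hx⟩ : ∃ x, y ≤ x ∧ x ≤ y + 2 ∧ (x % 4 = 2 ∨ (x - t) % 4 = 2) := by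
    by_cases hx : y % 4 = 2 ∨ (y - t) % 4 = 2
    · exact ⟨y, le_rfl, by omega, hx⟩
    · exact ⟨y + 2, by omega, le_rfl, by omega⟩
  rcases hx with hx | hx
  · exact not_both hx (Nat.odd_iff.2 (by omega)) (h x hyx hxy).symm
  · exact not_both hx (Nat.odd_iff.2 (by omega)) (h x hyx hxy)

-- Desubstitution: an even shift maps even positions to even positions, so halving all positions
-- turns the copy into a copy of half the length.
theorem CopyEndsAt.exists_shift {p n e : ℕ} (h : CopyEndsAt pdChar p n e) (he : e ≤ n) (m : ℕ)
    (hm : 3 * 2 ^ m ≤ 2 * (n - p)) :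
    ∃ t, n = e + 2 ^ m * t ∧
      ∀ y, p < 2 ^ m * y → 2 ^ m * y ≤ n → t < y ∧ pdChar (y - t) = pdChar y := by
  have shift_lt {m t y : ℕ} (ht : n = e + 2 ^ m * t) (hy : p < 2 ^ m * y) : t < y := by
    have := h.1
    exact Nat.lt_of_mul_lt_mul_left (a := 2 ^ m) (by omega)
  induction m with
  | zero =>
    refine ⟨n - e, by omega, fun y hpy hyn => ⟨shift_lt (m := 0) (by omega) hpy, ?_⟩⟩
    rw [pow_zero, one_mul] at hpy hyn
    rw [← h.2 y hpy hyn]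
    congr 1
    omega
  | succ m ih =>
    rw [pow_succ'] at hm
    have hpos : 0 < 2 ^ m := by positivity
    obtain ⟨t, ht, hshift⟩ := ih (by omega)
    have hp : p < 2 ^ m * (p / 2 ^ m + 1) := Nat.lt_mul_div_succ p (by positivity)
    have hp' : 2 ^ m * (p / 2 ^ m) ≤ p := Nat.mul_div_le p (2 ^ m)
    have heven : Even t := even_of_pdChar_sub_eq (shift_lt ht hp) fun x hx hx' => (hshift x
      (hp.trans_le (Nat.mul_le_mul_left _ hx))
      ((Nat.mul_le_mul_left _ hx').trans (by linarith [show p + 3 * 2 ^ m ≤ n by omega]))).2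
    obtain ⟨s, rfl⟩ := heven.two_dvd
    rw [← mul_assoc, ← pow_succ] at ht
    refine ⟨s, ht, fun y hpy hyn => ?_⟩
    have hsy := shift_lt ht hpy
    rw [pow_succ, mul_assoc] at hpy hyn
    obtain ⟨-, hy⟩ := hshift (2 * y) hpy hyn
    rw [← Nat.mul_sub, pdChar_two_mul_eq_iff (by omega) (by omega)] at hy
    exact ⟨hsy, hy⟩

theorem CopyEndsAt.mem_Ioo_lower {m γ n e : ℕ} (h : CopyEndsAt pdChar (8 * 2 ^ m - γ) n e)
    (h0 : 1 ≤ γ) (hγ : γ ≤ 2 * 2 ^ m) (hn : 10 * 2 ^ m - γ < n) (he : e ≤ 8 * 2 ^ m - γ) :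
    4 * 2 ^ m - γ < e ∧ e < 4 * 2 ^ m := by
  obtain ⟨t, rfl, hshift⟩ := h.exists_shift (by omega) m (by omega)
  obtain ⟨ht, heq⟩ := hshift 8 (by omega) (by omega)
  have ht6 : t = 6 := by
    rw [pdChar_eq_iff_of_le_ten (by omega) (by omega)] at heq
    obtain rfl | rfl | rfl : t = 0 ∨ t = 2 ∨ t = 6 := by omega
    all_goals omega
  subst ht6
  refine ⟨by omega, not_le.1 fun hle => ?_⟩
  obtain ⟨-, heq⟩ := hshift 10 (by omega) (by omega)
  rw [pdChar_eq_iff_of_le_ten (by omega) (by omega)] at heq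
  omega

theorem CopyEndsAt.mem_Ico_upper {m δ n e : ℕ} (h : CopyEndsAt pdChar (10 * 2 ^ m - δ) n e)
    (hδ : δ < 2 * 2 ^ m) (hn : 16 * 2 ^ m - δ ≤ n) (he : e ≤ 10 * 2 ^ m - δ) :
    8 * 2 ^ m - δ ≤ e ∧ e < 8 * 2 ^ m := by
  have hpow : 2 ^ (m + 2) = 4 * 2 ^ m := by ring
  obtain ⟨t, rfl, hshift⟩ := h.exists_shift (by omega) (m + 2) (by omega)
  obtain ⟨ht, heq⟩ := hshift 3 (by omega) (by omega)
  have ht2 : t = 2 := by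
    rw [pdChar_eq_iff_of_le_ten (by omega) (by omega)] at heq
    obtain rfl | rfl : t = 0 ∨ t = 2 := by omega
    all_goals omega
  subst ht2
  refine ⟨by omega, not_le.1 fun hle => ?_⟩
  obtain ⟨-, heq⟩ := hshift 4 (by omega) (by omega)
  rw [pdChar_eq_iff_of_le_ten (by omega) (by omega)] at heq
  omega

theorem CopyEndsAt.mem_Ioo_two_pow {j n e : ℕ} (h : CopyEndsAt pdChar (2 ^ j) n e)
    (hn : 13 * 2 ^ j < 8 * n) (he : e ≤ 2 ^ j) : 5 * 2 ^ j < 8 * e ∧ e < 2 ^ j := by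
  match j with
  | 0 =>
    obtain ⟨hle, hd⟩ := h
    obtain ⟨rfl, rfl⟩ : n = 2 ∧ e = 1 := by omega
    have := hd 2 (by omega) (by omega)
    rw [pdChar_eq_iff_of_le_ten (by omega) (by omega)] at this
    omega
  | 1 =>
    obtain ⟨hle, hd⟩ := h
    obtain ⟨rfl, rfl⟩ : n = 4 ∧ e = 2 := by omega
    have := hd 4 (by omega) (by omega)
    rw [pdChar_eq_iff_of_le_ten (by omega) (by omega)] at this
    omega
  | i + 2 =>
    have hpow : 2 ^ (i + 2) = 4 * 2 ^ i := by ring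
    have hpos : 0 < 2 ^ i := by positivity
    obtain ⟨t, rfl, hshift⟩ := h.exists_shift (by omega) i (by omega)
    obtain ⟨ht, heq⟩ := hshift 6 (by omega) (by omega)
    have ht4 : t = 4 := by
      rw [pdChar_eq_iff_of_le_ten (by omega) (by omega)] at heq
      obtain rfl | rfl : t = 0 ∨ t = 4 := by omega
      all_goals omega
    subst ht4
    refine ⟨by omega, not_le.1 fun hle => ?_⟩
    obtain ⟨-, heq⟩ := hshift 8 (by omega) (by omega)
    rw [pdChar_eq_iff_of_le_ten (by omega) (by omega)] at heq
    omega

/-! ### The LZ77 parsing -/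

theorem not_factor_infix_two_pow {k n : ℕ} (hn : 2 ^ (k + 1) ≤ n) :
    ¬ factor pdChar (2 ^ k) n <:+: factor pdChar 0 (2 ^ k) := by
  intro h
  have hlen : n = 2 ^ (k + 1) := by
    have := h.length_le
    simp only [length_factor] at this
    omega
  have heq : factor pdChar (2 ^ k) n = factor pdChar 0 (2 ^ k) :=
    h.eq_of_length (by simp only [length_factor]; omega)
  have hcopy : CopyEndsAt pdChar (2 ^ k) n (2 ^ k) :=
    (factor_suffix_iff _).1 (heq ▸ List.suffix_rfl)
  have hpos : 0 < 2 ^ k := by positivity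
  have hlast := hcopy.2 n (by omega) le_rfl
  rw [Nat.add_sub_cancel_left, hlen, pow_succ', pdChar_two_mul (by positivity)] at hlast
  simp at hlast

theorem exists_isGreedyParse_lz77 (k : ℕ) :
    ∃ l, IsGreedyParse LZ77Source pdChar (2 ^ k :: l) ∧ l.length = k + 1 := by
  induction k with
  | zero =>
    refine ⟨[0], .cons .zero one_pos (by simp [LZ77Source, phrases]) fun n hn h => ?_, rfl⟩
    exact factor_ne_nil pdChar hn (List.infix_nil.1 h)
  | succ k ih =>
    obtain ⟨l, hl, hlen⟩ := ih
    refine ⟨2 ^ k :: l, hl.cons (Nat.pow_lt_pow_succ one_lt_two) ?_ fun n hn h => ?_,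
      by simp [hlen]⟩
    · have hpos : 0 < 2 ^ k := by positivity
      have hcopy : CopyEndsAt pdChar (2 ^ k) (2 ^ (k + 1) - 1) (2 ^ k - 1) := by
        convert copyEndsAt_add_two_pow (j := k) (e := 2 ^ k - 1) le_rfl (by omega) using 1
        omega
      rw [LZ77Source, hl.flatten_phrases]
      exact ((factor_suffix_iff _).2 hcopy).isInfix.trans
        (factor_prefix _ (Nat.zero_le _) (by omega)).isInfix
    · rw [LZ77Source, hl.flatten_phrases] at h
      exact not_factor_infix_two_pow hn h

theorem numLZ77_periodDoubling (k : ℕ) : numLZ77 (periodDoubling k) = k + 1 := by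
  obtain ⟨l, hl, hlen⟩ := exists_isGreedyParse_lz77 k
  rw [periodDoubling_eq_factor, hl.numLZ77_head, hlen]

/-! ### The LZ-End parsing -/

/-- The distance from the last LZ-End phrase end at or before position `2 ^ j` of the infinite
period-doubling word to `2 ^ j`. Once it is positive it drops by one at each power of two; when it
has reached `0`, the next phrase ends at the position `⌊13 · 2 ^ j / 8⌋ + 1`. -/
def lzEndGap : ℕ → ℕ
  | 0 => 0
  | j + 1 => if lzEndGap j = 0 then (3 * 2 ^ j - 1) / 8 else lzEndGap j - 1

/-- The ends of the LZ-End phrases of the infinite period-doubling word up to position `2 ^ j`, from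
the last one down to `0`: one phrase is added when the previous gap is `0` and two otherwise. -/
def lzEnds : ℕ → List ℕ
  | 0 => [1, 0]
  | j + 1 =>
    if lzEndGap j = 0 then (2 ^ (j + 1) - lzEndGap (j + 1)) :: lzEnds j
    else (2 ^ (j + 1) - lzEndGap (j + 1)) :: (5 * 2 ^ j / 4 - lzEndGap (j + 1)) :: lzEnds j

theorem lzEndGap_succ_of_eq_zero {j : ℕ} (h : lzEndGap j = 0) :
    lzEndGap (j + 1) = (3 * 2 ^ j - 1) / 8 := by
  rw [lzEndGap, if_pos h]

theorem lzEndGap_succ_of_ne_zero {j : ℕ} (h : lzEndGap j ≠ 0) :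
    lzEndGap (j + 1) = lzEndGap j - 1 := by
  rw [lzEndGap, if_neg h]

theorem lzEndGap_lt (j : ℕ) : 16 * lzEndGap j < 3 * 2 ^ j := by
  induction j with
  | zero => simp [lzEndGap]
  | succ j ih =>
    have hpos : 0 < 2 ^ j := by positivity
    rw [lzEndGap, pow_succ']
    split_ifs <;> omega

theorem three_le_of_lzEndGap_ne_zero {j : ℕ} (h : lzEndGap j ≠ 0) : 3 ≤ j := by
  have := lzEndGap_lt j
  by_contra! hj
  interval_cases j <;> omega

theorem exists_lzEnds_eq_cons (j : ℕ) : ∃ l, lzEnds j = (2 ^ j - lzEndGap j) :: l := by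
  cases j with
  | zero => exact ⟨[0], by simp [lzEnds, lzEndGap]⟩
  | succ j =>
    rw [lzEnds]
    split_ifs
    · exact ⟨_, rfl⟩
    · exact ⟨_, rfl⟩

theorem head_mem_lzEnds (j : ℕ) : 2 ^ j - lzEndGap j ∈ lzEnds j := by
  obtain ⟨l, hl⟩ := exists_lzEnds_eq_cons j
  simp [hl]

theorem mem_lzEnds_succ {j e : ℕ} : e ∈ lzEnds (j + 1) ↔ e = 2 ^ (j + 1) - lzEndGap (j + 1) ∨
    (lzEndGap j ≠ 0 ∧ e = 5 * 2 ^ j / 4 - lzEndGap (j + 1)) ∨ e ∈ lzEnds j := by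
  rw [lzEnds]
  split_ifs with h <;> simp [h]

theorem eq_or_le_of_mem_lzEnds {j e : ℕ} (he : e ∈ lzEnds j) :
    e = 2 ^ j - lzEndGap j ∨ 8 * e ≤ 5 * 2 ^ j := by
  induction j with
  | zero =>
    simp only [lzEnds, List.mem_cons, List.not_mem_nil, or_false] at he
    simp only [lzEndGap]
    omega
  | succ j ih =>
    rcases mem_lzEnds_succ.1 he with rfl | ⟨-, rfl⟩ | he
    · exact Or.inl rfl
    · omega
    · rcases ih he with rfl | h <;> omega

theorem two_pow_le_of_mem_lzEnds_succ {j e : ℕ} (he : e ∈ lzEnds (j + 1))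
    (hlow : 2 ^ j - lzEndGap (j + 1) < e) : 2 ^ j ≤ e := by
  have hlt := lzEndGap_lt j
  have hlt' := lzEndGap_lt (j + 1)
  by_cases h0 : lzEndGap j = 0
  · rcases mem_lzEnds_succ.1 he with rfl | ⟨h, -⟩ | he
    · omega
    · exact absurd h0 h
    · rcases eq_or_le_of_mem_lzEnds he with rfl | h <;> omega
  · have hsucc := lzEndGap_succ_of_ne_zero h0
    rcases mem_lzEnds_succ.1 he with rfl | ⟨-, rfl⟩ | he
    · omega
    · omega
    · rcases eq_or_le_of_mem_lzEnds he with rfl | h <;> omega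

theorem five_mul_div_mem_lzEnds {j : ℕ} (h : lzEndGap j = 0) : 5 * 2 ^ j / 8 ∈ lzEnds j := by
  cases j with
  | zero => simp [lzEnds]
  | succ j =>
    by_cases h0 : lzEndGap j = 0
    · have hsucc := lzEndGap_succ_of_eq_zero h0
      have hpos : 0 < 2 ^ j := by positivity
      have hhead : 5 * 2 ^ (j + 1) / 8 = 2 ^ j - lzEndGap j := by omega
      rw [hhead]
      exact mem_lzEnds_succ.2 (Or.inr (Or.inr (head_mem_lzEnds j)))
    · exact mem_lzEnds_succ.2 (Or.inr (Or.inl ⟨h0, by omega⟩))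

theorem exists_two_pow_sub_one_mem_lzEnds (j : ℕ) :
    ∃ b, 2 ^ b - 1 ∈ lzEnds j ∧ lzEndGap (j + 1) ≤ 2 ^ b := by
  induction j with
  | zero => exact ⟨0, by simp [lzEnds], by simp [lzEndGap]⟩
  | succ j ih =>
    obtain ⟨b, hb, hgap⟩ := ih
    have hmem : 2 ^ b - 1 ∈ lzEnds (j + 1) := mem_lzEnds_succ.2 (Or.inr (Or.inr hb))
    by_cases h1 : lzEndGap (j + 1) = 0
    · have hsucc := lzEndGap_succ_of_eq_zero h1
      by_cases h0 : lzEndGap j = 0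
      · have hpos : 0 < 2 ^ b := by positivity
        have := lzEndGap_succ_of_eq_zero h0
        exact ⟨b, hmem, by omega⟩
      · have := lzEndGap_succ_of_ne_zero h0
        have hone : lzEndGap j = 1 := by omega
        exact ⟨j, mem_lzEnds_succ.2 (Or.inr (Or.inr (hone ▸ head_mem_lzEnds j))), by omega⟩
    · have := lzEndGap_succ_of_ne_zero h1
      exact ⟨b, hmem, by omega⟩

theorem IsGreedyParse.cons_lzEnds_of_eq_zero {j : ℕ}
    (h : IsGreedyParse LZEndSource pdChar (lzEnds j)) (h0 : lzEndGap j = 0) :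
    IsGreedyParse LZEndSource pdChar ((2 ^ (j + 1) - lzEndGap (j + 1)) :: lzEnds j) := by
  obtain ⟨l, hl⟩ := exists_lzEnds_eq_cons j
  rw [h0, Nat.sub_zero] at hl
  rw [hl] at h ⊢
  have hpos : 0 < 2 ^ j := by positivity
  have hsucc := lzEndGap_succ_of_eq_zero h0
  refine h.cons_lzEnd (by omega) (hl ▸ five_mul_div_mem_lzEnds h0) ?_ fun n hn e he hcopy => ?_
  · convert copyEndsAt_add_two_pow (p := 2 ^ j) (e := 5 * 2 ^ j / 8) le_rfl (by omega) using 1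
    omega
  · have hmem := eq_or_le_of_mem_lzEnds (hl ▸ he)
    have hwindow := hcopy.mem_Ioo_two_pow (by omega) (by omega)
    omega

theorem IsGreedyParse.cons_lower {m : ℕ} (h : IsGreedyParse LZEndSource pdChar (lzEnds (m + 3)))
    (h0 : lzEndGap (m + 3) ≠ 0) :
    IsGreedyParse LZEndSource pdChar ((10 * 2 ^ m - lzEndGap (m + 4)) :: lzEnds (m + 3)) := by
  have hlt := lzEndGap_lt (m + 3)
  have hsucc : lzEndGap (m + 4) = lzEndGap (m + 3) - 1 := lzEndGap_succ_of_ne_zero h0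
  have hpow : 2 ^ (m + 3) = 8 * 2 ^ m := by ring
  have hpow' : 2 ^ (m + 2) = 4 * 2 ^ m := by ring
  obtain ⟨l, hl⟩ := exists_lzEnds_eq_cons (m + 3)
  rw [hpow] at hl hlt
  rw [hl] at h ⊢
  refine h.cons_lzEnd (by omega) List.mem_cons_self ?_ fun n hn e he hcopy => ?_
  · convert copyEndsAt_lower (m := m) (γ := lzEndGap (m + 3)) (by omega) (by omega) using 1
    omega
  · have hmem := eq_or_le_of_mem_lzEnds (hl ▸ he)
    have hwindow := hcopy.mem_Ioo_lower (by omega) (by omega) (by omega) (by omega)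
    have hmid : 2 ^ (m + 2) - lzEndGap (m + 3) < e → 2 ^ (m + 2) ≤ e :=
      two_pow_le_of_mem_lzEnds_succ (hl ▸ he)
    omega

theorem IsGreedyParse.cons_upper {m : ℕ}
    (h : IsGreedyParse LZEndSource pdChar ((10 * 2 ^ m - lzEndGap (m + 4)) :: lzEnds (m + 3)))
    (h0 : lzEndGap (m + 3) ≠ 0) :
    IsGreedyParse LZEndSource pdChar
      ((16 * 2 ^ m - lzEndGap (m + 4)) :: (10 * 2 ^ m - lzEndGap (m + 4)) :: lzEnds (m + 3)) := by
  have hlt := lzEndGap_lt (m + 3)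
  have hsucc : lzEndGap (m + 4) = lzEndGap (m + 3) - 1 := lzEndGap_succ_of_ne_zero h0
  have hpow : 2 ^ (m + 3) = 8 * 2 ^ m := by ring
  refine h.cons_lzEnd (by omega) (List.mem_cons_of_mem _ (head_mem_lzEnds _)) ?_
    fun n hn e he hcopy => ?_
  · convert copyEndsAt_add_two_pow (j := m + 3) (p := 10 * 2 ^ m - lzEndGap (m + 4))
      (e := 2 ^ (m + 3) - lzEndGap (m + 3)) (by omega) (by omega) using 1
    omega
  · have hmem : e = 10 * 2 ^ m - lzEndGap (m + 4) ∨ e ≤ 8 * 2 ^ m - lzEndGap (m + 3) := by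
      rcases List.mem_cons.1 he with rfl | he
      · exact Or.inl rfl
      · have := eq_or_le_of_mem_lzEnds he
        omega
    have hwindow := hcopy.mem_Ico_upper (by omega) (by omega) (by omega)
    omega

theorem isGreedyParse_lzEnds (j : ℕ) : IsGreedyParse LZEndSource pdChar (lzEnds j) := by
  induction j with
  | zero =>
    refine .cons_lzEnd .zero one_pos (List.mem_singleton_self 0) ⟨le_rfl, by omega⟩
      fun n hn e he h => ?_
    have := h.1
    rw [List.mem_singleton.1 he] at this
    omega
  | succ j ih =>
    rw [lzEnds]
    split_ifs with h0
    · exact ih.cons_lzEnds_of_eq_zero h0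
    · obtain ⟨m, rfl⟩ := Nat.exists_eq_add_of_le' (three_le_of_lzEndGap_ne_zero h0)
      have hpow : 2 ^ (m + 3) = 8 * 2 ^ m := by ring
      have hlower : 5 * 2 ^ (m + 3) / 4 = 10 * 2 ^ m := by omega
      have hupper : 2 ^ (m + 3 + 1) = 16 * 2 ^ m := by omega
      rw [hlower, hupper]
      exact (ih.cons_lower h0).cons_upper h0

theorem length_lzEnds_add_count (j : ℕ) :
    (lzEnds j).length + Nat.count (lzEndGap · = 0) j = 2 * j + 2 := by
  induction j with
  | zero => simp [lzEnds]
  | succ j ih =>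
    rw [lzEnds, Nat.count_succ]
    split_ifs
    · rw [List.length_cons]
      omega
    · rw [List.length_cons, List.length_cons]
      omega

theorem numLZEnd_periodDoubling_add_count (k : ℕ) :
    numLZEnd (periodDoubling k) + Nat.count (lzEndGap · = 0) (k + 1) = 2 * k + 2 := by
  obtain ⟨l, hl⟩ := exists_lzEnds_eq_cons k
  have hlen := length_lzEnds_add_count k
  have hparse := isGreedyParse_lzEnds k
  rw [hl] at hparse hlen
  rw [List.length_cons] at hlen
  rw [periodDoubling_eq_factor, Nat.count_succ]
  split_ifs with h0
  · rw [h0, Nat.sub_zero] at hparse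
    rw [hparse.numLZEnd_head]
    omega
  · obtain ⟨j, rfl⟩ := Nat.exists_eq_add_one_of_ne_zero (n := k) (by rintro rfl; exact h0 rfl)
    obtain ⟨b, hb, hgap⟩ := exists_two_pow_sub_one_mem_lzEnds j
    have hlt := lzEndGap_lt (j + 1)
    rw [hparse.numLZEnd_factor (by omega) (hl ▸ mem_lzEnds_succ.2 (Or.inr (Or.inr hb)))
      (copyEndsAt_two_pow_sub_one (by omega) (by omega) hgap)]
    omega

/-! ### The iterated logarithm -/

theorem logStar_of_le_one {x : ℝ} (hx : x ≤ 1) : logStar x = 0 :=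
  Nat.sInf_eq_zero.2 (Or.inl hx)

theorem logStar_of_one_lt {x : ℝ} (hx : 1 < x) : logStar x = logStar (Real.logb 2 x) + 1 := by
  have hpos : 1 ≤ sInf {i : ℕ | (Real.logb 2)^[i] x ≤ 1} := by
    refine Nat.one_le_iff_ne_zero.2 fun h => ?_
    rcases Nat.sInf_eq_zero.1 h with h | h
    · exact hx.not_ge h
    · exact (logStar_nonempty x).ne_empty h
  exact (Nat.sInf_add hpos).symm

theorem logStar_mono : Monotone logStar := by
  intro x y hxy
  induction hn : logStar y generalizing x y with
  | zero =>
    have hy : y ≤ 1 := by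
      by_contra! hy
      simp [logStar_of_one_lt hy] at hn
    rw [logStar_of_le_one (hxy.trans hy)]
  | succ n ih =>
    rcases le_or_gt x 1 with hx | hx
    · rw [logStar_of_le_one hx]
      exact Nat.zero_le _
    · rw [logStar_of_one_lt (hx.trans_le hxy), Nat.add_right_cancel_iff] at hn
      rw [logStar_of_one_lt hx]
      exact Nat.add_le_add_right
        (ih (Real.logb_le_logb_of_le one_lt_two (by linarith) hxy) hn) 1

theorem logStar_two_pow {k : ℕ} (hk : 1 ≤ k) : logStar (2 ^ k) = logStar k + 1 := by
  rw [logStar_of_one_lt (one_lt_pow₀ one_lt_two (by omega)), Real.logb_pow,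
    Real.logb_self_eq_one one_lt_two, mul_one]

theorem logStar_le_of_le_natCast {n : ℕ} {x : ℝ} (hx : x ≤ n) : logStar x ≤ n := by
  induction n generalizing x with
  | zero => rw [logStar_of_le_one (by push_cast at hx; linarith)]
  | succ n ih =>
    rcases le_or_gt x 1 with h1 | h1
    · rw [logStar_of_le_one h1]
      exact Nat.zero_le _
    · rw [logStar_of_one_lt h1]
      refine Nat.add_le_add_right (ih ?_) 1
      rw [Real.logb_le_iff_le_rpow one_lt_two (by linarith), Real.rpow_natCast]
      exact hx.trans (mod_cast Nat.lt_two_pow_self)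

theorem logStar_natCast_isLittleO :
    (fun k : ℕ => (logStar k : ℝ)) =o[atTop] (fun k : ℕ => (k : ℝ)) := by
  have hlog : (fun x : ℝ => Real.logb 2 x + 2) =o[atTop] (fun x : ℝ => x) := by
    have h2 : (fun _ : ℝ => (2 : ℝ)) =o[atTop] (fun x : ℝ => x) := isLittleO_const_id_atTop 2
    have hlogb : Real.logb 2 = fun x => (Real.log 2)⁻¹ * Real.log x := by
      funext x
      rw [Real.logb, div_eq_inv_mul]
    refine IsLittleO.add ?_ h2
    rw [hlogb]
    exact Real.isLittleO_log_id_atTop.const_mul_left (Real.log 2)⁻¹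
  refine IsBigO.trans_isLittleO (.of_bound 1 ?_) (hlog.comp_tendsto tendsto_natCast_atTop_atTop)
  filter_upwards [eventually_gt_atTop 1] with k hk
  have hk' : (1 : ℝ) < k := mod_cast hk
  have hlogb : 0 < Real.logb 2 k := Real.logb_pos one_lt_two hk'
  have hceil : logStar (Real.logb 2 k) ≤ ⌈Real.logb 2 k⌉₊ :=
    logStar_le_of_le_natCast (Nat.le_ceil _)
  have hle : (logStar (Real.logb 2 k) : ℝ) ≤ Real.logb 2 k + 1 :=
    (Nat.cast_le.2 hceil).trans (Nat.ceil_lt_add_one hlogb.le).le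
  rw [logStar_of_one_lt hk', one_mul, Function.comp_apply, Real.norm_natCast,
    Real.norm_of_nonneg (by linarith)]
  push_cast
  linarith

/-! ### The deficit of the LZ-End parsing -/

-- `i + lzEndGap i` is constant while the gap is positive, and when the gap vanishes the next value
-- is exponential in `i`: each further zero thus raises `log*` of
-- the sum.
theorem count_lzEndGap_add_three_le (i : ℕ) : Nat.count (lzEndGap · = 0) (i + 3) ≤
    logStar ((i + 1 + lzEndGap (i + 3) : ℕ) : ℝ) + 2 := by
  induction i with
  | zero =>
    have h2 : logStar 2 = 1 := by
      simpa [logStar_of_le_one] using logStar_two_pow (k := 1) le_rfl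
    have hcount : Nat.count (lzEndGap · = 0) 3 = 3 := rfl
    have hgap : lzEndGap 3 = 1 := rfl
    rw [zero_add, hcount, hgap, zero_add, one_add_one_eq_two, Nat.cast_ofNat, h2]
  | succ i ih =>
    rw [show i + 1 + 3 = i + 3 + 1 by ring, Nat.count_succ]
    split_ifs with h0
    · have hgap := lzEndGap_succ_of_eq_zero h0
      have hpow : ((2 ^ (i + 1) : ℕ) : ℝ) ≤ ((i + 1 + 1 + lzEndGap (i + 3 + 1) : ℕ) : ℝ) := by
        have hpos : 0 < 2 ^ i := by positivity
        have hpow3 : 2 ^ (i + 3) = 8 * 2 ^ i := by ring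
        rw [Nat.cast_le]
        omega
      have hmono := logStar_mono hpow
      rw [Nat.cast_pow, Nat.cast_ofNat, logStar_two_pow (by omega)] at hmono
      rw [h0] at ih
      simp only [add_zero] at ih
      omega
    · have hgap := lzEndGap_succ_of_ne_zero h0
      rw [show i + 1 + 1 + lzEndGap (i + 3 + 1) = i + 1 + lzEndGap (i + 3) by omega, add_zero]
      exact ih

theorem count_lzEndGap_le {k : ℕ} (hk : 2 ≤ k) :
    Nat.count (lzEndGap · = 0) (k + 1) ≤ logStar k + 3 := by
  obtain ⟨i, rfl⟩ := Nat.exists_eq_add_of_le' hk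
  have hlt := lzEndGap_lt (i + 3)
  have hi : i < 2 ^ i := Nat.lt_two_pow_self
  have hpow : 2 ^ (i + 3) = 8 * 2 ^ i := by ring
  have hpow' : 2 ^ (i + 2) = 4 * 2 ^ i := by ring
  have hle : ((i + 1 + lzEndGap (i + 3) : ℕ) : ℝ) ≤ ((2 ^ (i + 2) : ℕ) : ℝ) := by
    rw [Nat.cast_le]
    omega
  have hmono := logStar_mono hle
  rw [Nat.cast_pow, Nat.cast_ofNat, logStar_two_pow (by omega)] at hmono
  have hcount : Nat.count (lzEndGap · = 0) (i + 2 + 1) ≤ _ := count_lzEndGap_add_three_le i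
  omega

theorem exists_numLZEnd_deficit : ∃ f : ℕ → ℕ,
    (∀ k, 1 ≤ k → numLZEnd (periodDoubling k) + f k = 2 * k) ∧
      (fun k : ℕ => (f k : ℝ)) =O[atTop] (fun k : ℕ => (logStar k : ℝ)) := by
  refine ⟨fun k => Nat.count (lzEndGap · = 0) (k + 1) - 2, fun k hk => ?_, .of_bound 2 ?_⟩
  · have hcount : Nat.count (lzEndGap · = 0) 2 ≤ Nat.count (lzEndGap · = 0) (k + 1) :=
      Nat.count_monotone _ (by omega)
    have htwo : Nat.count (lzEndGap · = 0) 2 = 2 := rfl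
    have := numLZEnd_periodDoubling_add_count k
    beta_reduce
    omega
  · filter_upwards [eventually_ge_atTop 2] with k hk
    have hcount := count_lzEndGap_le hk
    have hpos : 1 ≤ logStar k := by
      rw [logStar_of_one_lt (mod_cast hk)]
      omega
    rw [Real.norm_natCast, Real.norm_natCast]
    exact_mod_cast (by omega :
      Nat.count (lzEndGap · = 0) (k + 1) - 2 ≤ 2 * logStar k)

theorem tendsto_numLZEnd_div_numLZ77 {f : ℕ → ℕ}
    (hf : ∀ k, 1 ≤ k → numLZEnd (periodDoubling k) + f k = 2 * k)
    (hO : (fun k : ℕ => (f k : ℝ)) =O[atTop] (fun k : ℕ => (logStar k : ℝ))) :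
    Tendsto (fun k : ℕ => (numLZEnd (periodDoubling k) : ℝ) / numLZ77 (periodDoubling k)) atTop
      (𝓝 2) := by
  have hdeficit : Tendsto (fun k : ℕ => (f k : ℝ) / k) atTop (𝓝 0) :=
    (hO.trans_isLittleO logStar_natCast_isLittleO).tendsto_div_nhds_zero
  have hlim := (hdeficit.const_sub 2).mul (tendsto_natCast_div_add_atTop (1 : ℝ))
  rw [sub_zero, mul_one] at hlim
  refine hlim.congr' ?_
  filter_upwards [eventually_ge_atTop 1] with k hk
  have hk0 : (k : ℝ) ≠ 0 := by positivity
  have hnum : (numLZEnd (periodDoubling k) : ℝ) = 2 * k - f k :=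
    eq_sub_of_add_eq (mod_cast hf k hk)
  rw [numLZ77_periodDoubling, hnum]
  push_cast
  field_simp

/-! ### Unary strings -/

section Unary

variable {α : Type*}

theorem LZEndSource.lz77Source {pre : List (List α)} {u : List α} (h : LZEndSource pre u) :
    LZ77Source pre u := by
  obtain ⟨j, -, h⟩ := h
  exact h.isInfix.trans (List.take_prefix j pre).flatten.isInfix

theorem lzEndSource_iff_lz77Source {pre : List (List α)} {c : α} (h : ∀ x ∈ pre.flatten, x = c)
    (u : List α) : LZEndSource pre u ↔ LZ77Source pre u := by
  refine ⟨LZEndSource.lz77Source, fun hu => ⟨pre.length, le_rfl, ?_⟩⟩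
  rw [List.take_length, List.eq_replicate_of_mem h,
    List.eq_replicate_of_mem fun x hx => h x (hu.subset hx), List.suffix_replicate_iff]
  simpa using hu.length_le

theorem lz77_replicate (c : α) (n : ℕ) :
    lz77 (List.replicate n c) = lzEnd (List.replicate n c) := by
  obtain ⟨hflat, hgreedy⟩ := lzEnd_eq_iff.1 (Eq.refl (lzEnd (List.replicate n c)))
  refine lz77_eq_iff.2 ⟨hflat, fun pre x post hsplit => ?_⟩
  have hpre : ∀ y ∈ pre.flatten, y = c := by
    intro y hy
    rw [hsplit, List.flatten_append] at hflat
    exact List.eq_of_mem_replicate (hflat ▸ List.mem_append_left _ hy)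
  simpa only [IsLongestPrefix, lzEndSource_iff_lz77Source hpre] using hgreedy pre x post hsplit

theorem not_tendsto_two_of_unary {w : ℕ → List α} (hw : ∀ m, ∃ c n, w m = List.replicate n c) :
    ¬ Tendsto (fun m => (numLZEnd (w m) : ℝ) / numLZ77 (w m)) atTop (𝓝 2) := by
  intro h
  have hle : ∀ m, (numLZEnd (w m) : ℝ) / numLZ77 (w m) ≤ 1 := by
    intro m
    obtain ⟨c, n, hm⟩ := hw m
    rw [hm, numLZEnd, numLZ77, lz77_replicate]
    exact div_self_le_one _
  exact absurd (le_of_tendsto' h hle) (by norm_num)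

end Unary

end LZ

theorem corollary1 :
    -- the LZ77 count of the period-doubling sequences
    (∀ k : ℕ, LZ.numLZ77 (LZ.periodDoubling k) = k + 1) ∧
    -- the LZ-End count of the period-doubling sequences: `2 k - f k` with `f k = O(log* k)`
    (∃ f : ℕ → ℕ,
      (∀ k : ℕ, 1 ≤ k → LZ.numLZEnd (LZ.periodDoubling k) + f k = 2 * k) ∧
      (fun k : ℕ => (f k : ℝ)) =O[atTop] (fun k : ℕ => (LZ.logStar (k : ℝ) : ℝ))) ∧
    -- the ratio tends to 2 along this family of binary strings
    Tendsto (fun k : ℕ => (LZ.numLZEnd (LZ.periodDoubling k) : ℝ) /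
      (LZ.numLZ77 (LZ.periodDoubling k) : ℝ)) atTop (𝓝 2) ∧
    -- on unary strings the two factorizations coincide
    (∀ (α : Type*) (c : α) (n : ℕ),
      LZ.lz77 (List.replicate n c) = LZ.lzEnd (List.replicate n c)) ∧
    -- so no family of unary strings has a ratio that tends to 2
    (∀ (α : Type*) (w : ℕ → List α), (∀ m, ∃ (c : α) (n : ℕ), w m = List.replicate n c) →
      ¬ Tendsto (fun m : ℕ => (LZ.numLZEnd (w m) : ℝ) / (LZ.numLZ77 (w m) : ℝ)) atTop (𝓝 2)) := by
  obtain ⟨f, hf, hO⟩ := LZ.exists_numLZEnd_deficit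
  exact ⟨LZ.numLZ77_periodDoubling, ⟨f, hf, hO⟩, LZ.tendsto_numLZEnd_div_numLZ77 hf hO,
    fun _ => LZ.lz77_replicate, fun _ _ => LZ.not_tendsto_two_of_unary⟩
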